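/- Let $\mathfrak g$ be a finite-dimensional simple Lie algebra over $\mathbb C$ with Killing form $\langle\cdot,\cdot\rangle$, let $\mathfrak h$ be a Cartan subalgebra, let $\alpha_1,\dots,\alpha_n$ be a base of the root system with positive roots $\Delta_+$, and put $\mathfrak n_\pm=\sum_{\alpha\in\Delta_+}\mathfrak g_{\pm\alpha}$. Choose $E_{\pm\alpha}\in\mathfrak g_{\pm\alpha}$ ($\alpha\in\Delta_+$) with $\langle E_\alpha,E_{-\alpha}\rangle=1$, put $h_i=[E_{\alpha_i},E_{-\alpha_i}]$, and let $(\lambda_1,\dots,\lambda_n)$ be the linear coordinates on $\mathfrak h^*$ with respect to the basis dual to $(h_1,\dots,h_n)$; they identify $\mathfrak h^*$ with $\mathbb C^n$. Let $U\subset\mathfrak h^*$ be a non-empty connected open set. For a bivector write $(x\wedge y)^\#(\xi)=\xi(y)\,x-\xi(x)\,y$ and $\Lambda(\xi,\eta)=\langle\eta,\Lambda^\#\xi\rangle$. Let $A=TU\times\mathfrak g$ be the holomorphic Lie algebroid over $U$ whose anchor is the projection to $TU$ and whose bracket is $[X+\xi,Y+\eta]=[X,Y]+[\xi,\eta]+L_X\eta-L_Y\xi$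 for vector fields $X,Y$ and $\mathfrak g$-valued functions $\xi,\eta$. Let $r_0=\sum_{\alpha\in\Delta_+}E_\alpha\wedge E_{-\alpha}$, and give $A^*$ the Lie algebroid structure with anchor $a\circ r_0^\#$ ($a$ the anchor of $A$) and bracket $[\xi,\eta]=L_{r_0^\#\xi}\eta-L_{r_0^\#\eta}\xi-d\,(r_0(\xi,\eta))$. On $E=A\oplus A^*$ consider the pairing $(X_1+\xi_1,X_2+\xi_2)=\frac12(\langle\xi_1,X_2\rangle+\langle\xi_2,X_1\rangle)$ and the bracket of sections $$[X_1+\xi_1,X_2+\xi_2]=\Big([X_1,X_2]+L_{\xi_1}X_2-L_{\xi_2}X_1-\tfrac12 d_*f\Big)+\Big([\xi_1,\xi_2]+L_{X_1}\xi_2-L_{X_2}\xi_1+\tfrac12 df\Big),\qquad f=\langle\xi_1,X_2\rangle-\langle\xi_2,X_1\rangle,$$ where $d$, $d_*$ and the Lie derivatives are those of $A$ and $A^*$. A *Dirac structure* is a holomorphic subbundle of $E$ which is maximally isotropic for the pairing and whose holomorphic sections over $U$ are closed under the bracket. Let $\theta=\sum_i h_i\wedge\frac{\partial}{\partial\lambda_i}$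 and $\tau(\lambda)=\sum_{\alpha\in\Delta_+}\tau_\alpha(\lambda)E_\alpha\wedge E_{-\alpha}$ with holomorphic functions $\tau_\alpha:U\to\mathbb C$, let $r=r_0+\tau$, and regard $\tau^\#(\lambda)$, $r^\#(\lambda)$ as endomorphisms of $\mathfrak g$ through the identification $\mathfrak g\cong\mathfrak g^*$ by the Killing form. For $\lambda\in U$ put $$\mathfrak k_\pm(\lambda)=\ker\tau^\#(\lambda)\cap\mathfrak n_\pm,\qquad \mathfrak n^\circ_\pm(\lambda)=\operatorname{span}_{\mathbb C}\{E_{\pm\alpha}\mid\alpha\in\Delta_+,\ \tau_\alpha(\lambda)\ne0\}.$$ **Lemma.** Suppose that the graph $L=\{(\theta^\#+\tau^\#)\xi+\xi\mid\xi\in A^*\}\subset E$ of $\theta^\#+\tau^\#:A^*\to A$ is a Dirac structure. Then $\mathfrak n_\pm=\mathfrak k_\pm(\lambda)\oplus\mathfrak n^\circ_\pm(\lambda)$ for all $\lambda\in U$, and: 1. $\mathfrak k_\pm(\lambda)$ and $\mathfrak n^\circ_\pm(\lambda)$ do not depend on $\lambda\in U$; 2. $\mathfrak n^\circ_\pm$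 are subalgebras of $\mathfrak n_\pm$; 3. $\mathfrak k_\pm$ are ideals of $\mathfrak n_\pm$, provided that the Cayley transform $\varphi(\lambda)=\frac{r^\#(\lambda)+1}{r^\#(\lambda)-1}$ of $r^\#(\lambda)$ on $\mathfrak n^\circ_+(\lambda)$ and on $\mathfrak n^\circ_-(\lambda)$ is defined at some $\lambda\in U$, i.e. $r^\#(\lambda)-1$ maps each of these two spaces bijectively onto itself. -/

import Mathlib

open Module LieAlgebra

noncomputable section

namespace DynR

/-! ### Holomorphic sections of trivial bundles

The base is an open subset of `B = (ι → ℂ)`; a section of the trivial bundle with fibre `V`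
is a function `B → V`, only its values on the open subset being relevant. -/

section Calculus

variable {ι : Type*} [Fintype ι] {V : Type*} [AddCommGroup V] [Module ℂ V]

/-- `s` is holomorphic on `U`. The fibre `V` is finite dimensional in all uses, so this can be
tested on linear functionals. -/
def HolOn (U : Set (ι → ℂ)) (s : (ι → ℂ) → V) : Prop :=
  ∀ φ : Dual ℂ V, DifferentiableOn ℂ (fun q => φ (s q)) U

/-- The derivative of `s` at `p` in the direction `v`, computed componentwise in a basis of the
finite-dimensional space `V` (for a section that is holomorphic near `p` the basis does not
matter). -/
def dirDeriv [FiniteDimensional ℂ V] (s : (ι → ℂ) → V) (p v : ι → ℂ) : V :=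
  ∑ j, fderiv ℂ (fun q => (finBasis ℂ V).repr (s q) j) p v • finBasis ℂ V j

end Calculus

/-! ### Lie algebroids on trivial bundles and their calculus -/

/-- The anchor (into the tangent bundle, whose fibre is `ι → ℂ`) and the bracket of sections of a
Lie algebroid on the trivial bundle with fibre `V`. This only stores the two operations; all
the instances used below are explicit. -/
structure Algebroid (ι V : Type*) [AddCommGroup V] [Module ℂ V] where
  anchor : (ι → ℂ) → V →ₗ[ℂ] (ι → ℂ)
  bracket : ((ι → ℂ) → V) → ((ι → ℂ) → V) → (ι → ℂ) → V

namespace Algebroid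

variable {ι V : Type*} [Fintype ι] [AddCommGroup V] [Module ℂ V] [FiniteDimensional ℂ V]

/-- The differential of a function: `⟨d f, X⟩ = a(X) f`. -/
def d (A : Algebroid ι V) (f : (ι → ℂ) → ℂ) (p : ι → ℂ) : Dual ℂ V :=
  (fderiv ℂ f p : (ι → ℂ) →ₗ[ℂ] ℂ) ∘ₗ A.anchor p

/-- The Lie derivative `L_X ξ` of a section `ξ` of the dual bundle:
`⟨L_X ξ, Y⟩ = a(X)⟨ξ, Y⟩ - ⟨ξ, [X, Y]⟩`. The right-hand side is `C^∞`-linear in `Y`, so it is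
enough to let `Y` be a constant section; the constant sections `Y` run over a basis of `V`. -/
def lieDeriv (A : Algebroid ι V) (X : (ι → ℂ) → V) (ξ : (ι → ℂ) → Dual ℂ V) (p : ι → ℂ) :
    Dual ℂ V :=
  (finBasis ℂ V).constr ℂ fun j =>
    fderiv ℂ (fun q => ξ q (finBasis ℂ V j)) p (A.anchor p (X p))
      - ξ p (A.bracket X (fun _ => finBasis ℂ V j) p)

/-- The algebroid on the dual bundle defined by a bivector field `Λ`, recorded through its sharp
map `Λ^# : V^* → V`, where `Λ(ξ, η) = ⟨η, Λ^# ξ⟩`: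
`[ξ, η] = L_{Λ^# ξ} η - L_{Λ^# η} ξ - d (Λ(ξ, η))`, with anchor `a ∘ Λ^#`. -/
def coboundaryDual (A : Algebroid ι V) (Λ : (ι → ℂ) → Dual ℂ V →ₗ[ℂ] V) :
    Algebroid ι (Dual ℂ V) where
  anchor p := A.anchor p ∘ₗ Λ p
  bracket ξ η p :=
    A.lieDeriv (fun q => Λ q (ξ q)) η p - A.lieDeriv (fun q => Λ q (η q)) ξ p
      - A.d (fun q => η q (Λ q (ξ q))) p

end Algebroid

/-! ### The double of a pair of algebroids in duality, and Dirac structures -/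

section Double

variable {ι V : Type*} [Fintype ι] [AddCommGroup V] [Module ℂ V] [FiniteDimensional ℂ V]

/-- `(X₁ + ξ₁, X₂ + ξ₂) = ½ (⟨ξ₁, X₂⟩ + ⟨ξ₂, X₁⟩)` on `V ⊕ V^*`. -/
def pairing (e₁ e₂ : V × Dual ℂ V) : ℂ :=
  (1 / 2 : ℂ) * (e₁.2 e₂.1 + e₂.2 e₁.1)

/-- The bracket on sections of `E = A ⊕ A^*`:
`[X₁ + ξ₁, X₂ + ξ₂]
  = ([X₁, X₂] + L_{ξ₁} X₂ - L_{ξ₂} X₁ - ½ d_* (⟨ξ₁, X₂⟩ - ⟨ξ₂, X₁⟩))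
  + ([ξ₁, ξ₂] + L_{X₁} ξ₂ - L_{X₂} ξ₁ + ½ d (⟨ξ₁, X₂⟩ - ⟨ξ₂, X₁⟩))`.
The operations `L_ξ` and `d_*` of `A^*` take values in `V^{**}`, identified with `V`. -/
def courantBracket (A : Algebroid ι V) (A' : Algebroid ι (Dual ℂ V))
    (e₁ e₂ : (ι → ℂ) → V × Dual ℂ V) (p : ι → ℂ) : V × Dual ℂ V :=
  let X₁ : (ι → ℂ) → V := fun q => (e₁ q).1
  let X₂ : (ι → ℂ) → V := fun q => (e₂ q).1
  let ξ₁ : (ι → ℂ) → Dual ℂ V := fun q => (e₁ q).2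
  let ξ₂ : (ι → ℂ) → Dual ℂ V := fun q => (e₂ q).2
  let f : (ι → ℂ) → ℂ := fun q => ξ₁ q (X₂ q) - ξ₂ q (X₁ q)
  (A.bracket X₁ X₂ p
      + (evalEquiv ℂ V).symm (A'.lieDeriv ξ₁ (fun q => evalEquiv ℂ V (X₂ q)) p)
      - (evalEquiv ℂ V).symm (A'.lieDeriv ξ₂ (fun q => evalEquiv ℂ V (X₁ q)) p)
      - (1 / 2 : ℂ) • (evalEquiv ℂ V).symm (A'.d f p),
   A'.bracket ξ₁ ξ₂ p + A.lieDeriv X₁ ξ₂ p - A.lieDeriv X₂ ξ₁ p + (1 / 2 : ℂ) • A.d f p)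

/-- `L` is a holomorphic subbundle over `U` of the trivial bundle with fibre `W`: it has constant
rank and local holomorphic frames. -/
def IsHolSubbundle {W : Type*} [AddCommGroup W] [Module ℂ W]
    (U : Set (ι → ℂ)) (L : (ι → ℂ) → Submodule ℂ W) : Prop :=
  ∃ k : ℕ, ∀ p ∈ U, ∃ N : Set (ι → ℂ), IsOpen N ∧ p ∈ N ∧ N ⊆ U ∧
    ∃ e : Fin k → (ι → ℂ) → W, (∀ j, HolOn N (e j)) ∧
      ∀ q ∈ N, LinearIndependent ℂ (fun j => e j q) ∧
        Submodule.span ℂ (Set.range fun j => e j q) = L q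

/-- A subspace on which the pairing vanishes. -/
def IsIsotropic (M : Submodule ℂ (V × Dual ℂ V)) : Prop :=
  ∀ x ∈ M, ∀ y ∈ M, pairing x y = 0

/-- The holomorphic sections over `U` of a family of subspaces. -/
def IsSection {W : Type*} [AddCommGroup W] [Module ℂ W]
    (U : Set (ι → ℂ)) (L : (ι → ℂ) → Submodule ℂ W) (s : (ι → ℂ) → W) : Prop :=
  HolOn U s ∧ ∀ p ∈ U, s p ∈ L p

/-- A Dirac structure over `U`: a holomorphic subbundle of `A ⊕ A^*` that is maximally isotropic
and whose space of holomorphic sections is closed under the bracket. -/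
structure IsDirac (A : Algebroid ι V) (A' : Algebroid ι (Dual ℂ V)) (U : Set (ι → ℂ))
    (L : (ι → ℂ) → Submodule ℂ (V × Dual ℂ V)) : Prop where
  subbundle : IsHolSubbundle U L
  isotropic : ∀ p ∈ U, IsIsotropic (L p)
  maximal : ∀ p ∈ U, ∀ M : Submodule ℂ (V × Dual ℂ V), IsIsotropic M → L p ≤ M → M = L p
  integrable : ∀ e₁ e₂ : (ι → ℂ) → V × Dual ℂ V, IsSection U L e₁ → IsSection U L e₂ →
    IsSection U L (courantBracket A A' e₁ e₂)

end Double

/-! ### Bivectors -/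

section Bivector

variable {V : Type*} [AddCommGroup V] [Module ℂ V]

/-- The sharp map `V^* → V` of the bivector `x ∧ y`, namely `ξ ↦ ξ(y) x - ξ(x) y`. -/
def wedgeSharp (x y : V) : Dual ℂ V →ₗ[ℂ] V :=
  (Dual.eval ℂ V y).smulRight x - (Dual.eval ℂ V x).smulRight y

/-- The graph `{Λ^# ξ + ξ}` of a map `V^* → V`. -/
def graphOf (Λ : Dual ℂ V →ₗ[ℂ] V) : Submodule ℂ (V × Dual ℂ V) :=
  LinearMap.range (Λ.prod LinearMap.id)

end Bivector

/-! ### The gauge algebroid `T U × 𝔤` -/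

section Gauge

variable (ι 𝔤 : Type*) [Fintype ι] [LieRing 𝔤] [LieAlgebra ℂ 𝔤] [FiniteDimensional ℂ 𝔤]

/-- The Lie algebroid `A = T U × 𝔤`: the anchor is the projection to `T U`, and
`[X + ξ, Y + η] = [X, Y] + [ξ, η] + L_X η - L_Y ξ`. -/
def gauge : Algebroid ι ((ι → ℂ) × 𝔤) where
  anchor _ := LinearMap.fst ℂ (ι → ℂ) 𝔤
  bracket s t p :=
    (dirDeriv (fun q => (t q).1) p (s p).1 - dirDeriv (fun q => (s q).1) p (t p).1,
      ⁅(s p).2, (t p).2⁆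
        + dirDeriv (fun q => (t q).2) p (s p).1 - dirDeriv (fun q => (s q).2) p (t p).1)

variable {𝔤}

/-- A bivector on `𝔤` regarded as a bivector on the fibre of `T U × 𝔤`. -/
def inGauge (Λ : Dual ℂ 𝔤 →ₗ[ℂ] 𝔤) :
    Dual ℂ ((ι → ℂ) × 𝔤) →ₗ[ℂ] (ι → ℂ) × 𝔤 :=
  LinearMap.inr ℂ (ι → ℂ) 𝔤 ∘ₗ Λ ∘ₗ (LinearMap.inr ℂ (ι → ℂ) 𝔤).dualMap

end Gauge

/-! ### Root vectors and the objects attached to `τ` -/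

section Roots

variable {𝔤 : Type*} [LieRing 𝔤] [LieAlgebra ℂ 𝔤] [FiniteDimensional ℂ 𝔤] [IsSimple ℂ 𝔤]
  {H : LieSubalgebra ℂ 𝔤} [H.IsCartanSubalgebra]

/-- The positive roots relative to a base of the root system. -/
abbrev Pos (b : (IsKilling.rootSystem H).Base) : Type _ := {α : H.root // b.IsPos α}

instance (b : (IsKilling.rootSystem H).Base) : Fintype (Pos b) := Fintype.ofFinite _

/-- A simple root as a positive root. -/
def simplePos (b : (IsKilling.rootSystem H).Base) (i : b.support) : Pos b :=
  ⟨i.1, RootPairing.Base.isPos_of_mem_support i.2⟩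

/-- For `ε = ±1` and a positive root `α`, the root space `𝔤_{εα}`. -/
def posSpace (b : (IsKilling.rootSystem H).Base) (ε : ℤˣ) (α : Pos b) : Submodule ℂ 𝔤 :=
  (rootSpace H ((ε : ℤ) • (α.1.1 : H → ℂ))).toSubmodule

/-- A choice of root vectors `E_{±α}`, `α` a positive root, with `⟨E_α, E_{-α}⟩ = 1` for the
Killing form. Here `E.vec ε α` is `E_{εα}`, for `ε = ±1`. -/
structure RootVectors (b : (IsKilling.rootSystem H).Base) where
  vec : ℤˣ → Pos b → 𝔤
  mem : ∀ ε α, vec ε α ∈ posSpace b ε α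
  norm : ∀ α, killingForm ℂ 𝔤 (vec 1 α) (vec (-1) α) = 1

/-- `𝔫_±`, the sum of the root spaces of the positive (negative) roots. -/
def nil (b : (IsKilling.rootSystem H).Base) (ε : ℤˣ) : Submodule ℂ 𝔤 :=
  ⨆ α : Pos b, posSpace b ε α

variable {b : (IsKilling.rootSystem H).Base} (E : RootVectors b)

/-- The sharp map of `∑_{α > 0} c_α E_α ∧ E_{-α}`. -/
def rootSharp (c : Pos b → ℂ) : Dual ℂ 𝔤 →ₗ[ℂ] 𝔤 :=
  ∑ α, c α • wedgeSharp (E.vec 1 α) (E.vec (-1) α)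

/-- The sharp map of the standard r-matrix `r₀ = ∑_{α > 0} E_α ∧ E_{-α}`. -/
def r0Sharp : Dual ℂ 𝔤 →ₗ[ℂ] 𝔤 := rootSharp E fun _ => 1

/-- `h_i = [E_{α_i}, E_{-α_i}]` for a simple root `α_i`. -/
def simpleH (i : b.support) : 𝔤 := ⁅E.vec 1 (simplePos b i), E.vec (-1) (simplePos b i)⁆

/-- The sharp map of `θ = ∑_i h_i ∧ ∂/∂λ_i`, where `(λ_i)` are the coordinates of `𝔥^*` given by
the basis dual to `(h_i)`, indexed by the simple roots. -/
def thetaSharp : Dual ℂ ((b.support → ℂ) × 𝔤) →ₗ[ℂ] (b.support → ℂ) × 𝔤 :=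
  open Classical in
  ∑ i : b.support, wedgeSharp ((0 : b.support → ℂ), simpleH E i) (Pi.single i 1, (0 : 𝔤))

/-- The Lie algebroid `A = T U × 𝔤`, `U ⊆ 𝔥^*`. -/
def algA (b : (IsKilling.rootSystem H).Base) : Algebroid b.support ((b.support → ℂ) × 𝔤) :=
  gauge b.support 𝔤

/-- The Lie algebroid `A^*`, with structure induced by `r₀`. -/
def algAStar : Algebroid b.support (Dual ℂ ((b.support → ℂ) × 𝔤)) :=
  (algA b).coboundaryDual fun _ => inGauge b.support (r0Sharp E)

/-- The graph `L` of `θ^# + τ^#`, where `τ(λ) = ∑_{α > 0} τ_α(λ) E_α ∧ E_{-α}`. -/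
def graphL (τ : (b.support → ℂ) → Pos b → ℂ) (p : b.support → ℂ) :
    Submodule ℂ (((b.support → ℂ) × 𝔤) × Dual ℂ ((b.support → ℂ) × 𝔤)) :=
  graphOf (thetaSharp E + inGauge b.support (rootSharp E (τ p)))

/-- A map `𝔤^* → 𝔤` as an endomorphism of `𝔤`, through the identification of `𝔤` with `𝔤^*` by
the Killing form. -/
def viaKilling (Λ : Dual ℂ 𝔤 →ₗ[ℂ] 𝔤) : 𝔤 →ₗ[ℂ] 𝔤 := Λ ∘ₗ killingForm ℂ 𝔤

/-- `𝔨_± = ker τ^# ∩ 𝔫_±`, where `τ = ∑_{α > 0} c_α E_α ∧ E_{-α}`. -/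
def kPart (c : Pos b → ℂ) (ε : ℤˣ) : Submodule ℂ 𝔤 :=
  LinearMap.ker (viaKilling (rootSharp E c)) ⊓ nil b ε

/-- `𝔫°_± = span {E_{±α} | c_α ≠ 0}`. -/
def nCirc (c : Pos b → ℂ) (ε : ℤˣ) : Submodule ℂ 𝔤 :=
  Submodule.span ℂ {x | ∃ α : Pos b, c α ≠ 0 ∧ x = E.vec ε α}

/-- The Cayley transform `φ = (r^# + 1) / (r^# - 1)` of `r^# = r₀^# + τ^#` on `𝔫°_+` and on
`𝔫°_-` is defined, that is, `r^# - 1` maps each of the two spaces bijectively onto itself. -/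
def CayleyDefined (c : Pos b → ℂ) : Prop :=
  ∀ ε : ℤˣ, Set.BijOn (fun x => viaKilling (r0Sharp E + rootSharp E c) x - x)
    (nCirc E c ε : Set 𝔤) (nCirc E c ε : Set 𝔤)

end Roots

end DynR

end

/-! Pairing the integrability of the graph `L` with suitable covectors turns it into scalar
equations for the functions `τ α`. The sections over the covectors `⟨E_{εα}, ·⟩` are `ε τ_α E_{εα} +
⟨E_{εα}, ·⟩`. The bracket of two of them must lie in `L`, and by skew-symmetry of `θ^# + τ^#` this
can be tested by pairing with an arbitrary third covector (`IsDirac.equation`).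

For `E_α`, `E_{-α}` and a third covector `⟨h, ·⟩` with `h` in the Cartan subalgebra, this gives `∂_v
τ_α = k τ_α (τ_α + 2)` with `k` constant on `U`, for every direction `v` (`IsDirac.deriv_eq`). Zero
solves this equation, so by uniqueness for ODEs and connectedness `τ_α` vanishes everywhere on `U`
or nowhere. Since `𝔨_±` and `𝔫°_±` are spanned by the root vectors with `τ_α = 0` and `τ_α ≠ 0`
respectively, both are constant.

For `E_{εα}`, `E_{εβ}` with nonzero bracket `N E_{εγ}` and third covector `⟨E_{-εγ}, ·⟩`, it gives
`τ_α τ_β = τ_γ (2 + τ_α + τ_β)` (`IsDirac.sum_relation`). If `τ_α` and `τ_β` are nonzero, so is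
`τ_γ`: this is the subalgebra property. If `τ_β = 0`, then `τ_γ (2 + τ_α) = 0`. As `r^# - 1` acts on
`E_{-α}` by `-(2 + τ_α)`, the Cayley condition excludes `τ_α = -2`, so `τ_γ = 0`: this is the ideal
property. -/

namespace DynR

/-! ### Brackets of sections in the double of the gauge algebroid -/

section GaugeCalculus

variable {ι 𝔤 : Type*} [Fintype ι]

lemma dirDeriv_smul {V : Type*} [AddCommGroup V] [Module ℂ V] [FiniteDimensional ℂ V]
    {a : (ι → ℂ) → ℂ} {p : ι → ℂ} (ha : DifferentiableAt ℂ a p) (w : V) (v : ι → ℂ) :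
    dirDeriv (fun q => a q • w) p v = fderiv ℂ a p v • w := by
  simp only [dirDeriv, map_smul, Finsupp.smul_apply, smul_eq_mul]
  conv_rhs => rw [← (finBasis ℂ V).sum_repr w, Finset.smul_sum]
  refine Finset.sum_congr rfl fun j _ => ?_
  rw [fderiv_mul_const ha, smul_smul]
  simp [mul_comm]

omit [Fintype ι] in
@[simp]
lemma dirDeriv_const {V : Type*} [AddCommGroup V] [Module ℂ V] [FiniteDimensional ℂ V]
    (w : V) (p v : ι → ℂ) : dirDeriv (fun _ => w) p v = 0 := by
  simp [dirDeriv]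

-- Frees `lieDeriv` from the chosen basis: a functional satisfying the defining formula on every
-- constant section is the Lie derivative.
omit [Fintype ι] in
lemma Algebroid.lieDeriv_eq {V : Type*} [AddCommGroup V] [Module ℂ V] [FiniteDimensional ℂ V]
    (A : Algebroid ι V) (X : (ι → ℂ) → V) (ξ : (ι → ℂ) → Dual ℂ V) (p : ι → ℂ) (g : Dual ℂ V)
    (h : ∀ w, fderiv ℂ (fun q => ξ q w) p (A.anchor p (X p))
      - ξ p (A.bracket X (fun _ => w) p) = g w) : A.lieDeriv X ξ p = g := by
  refine (finBasis ℂ V).ext fun j => ?_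
  rw [Algebroid.lieDeriv, Basis.constr_basis, h]

variable [LieRing 𝔤] [LieAlgebra ℂ 𝔤] [FiniteDimensional ℂ 𝔤]

/-- The section `a x` has zero anchor, so only `ζ([a x, w])` contributes. The Leibniz rule gives `[a
x, w] = a [x, w.2] - (∂a along w.1) x`. -/
lemma gauge_lieDeriv {a : (ι → ℂ) → ℂ} {p : ι → ℂ} (ha : DifferentiableAt ℂ a p) (x : 𝔤)
    (ζ : Dual ℂ ((ι → ℂ) × 𝔤)) (w : (ι → ℂ) × 𝔤) :
    (gauge ι 𝔤).lieDeriv (fun q => (0, a q • x)) (fun _ => ζ) p w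
      = fderiv ℂ a p w.1 * ζ (0, x) - a p * ζ (0, ⁅x, w.2⁆) := by
  rw [Algebroid.lieDeriv_eq (g := ζ (0, x) • ((fderiv ℂ a p : (ι → ℂ) →ₗ[ℂ] ℂ) ∘ₗ
    LinearMap.fst ℂ _ _) - a p • (ζ ∘ₗ LinearMap.inr ℂ _ _ ∘ₗ
      (ad ℂ 𝔤 x : 𝔤 →ₗ[ℂ] 𝔤) ∘ₗ LinearMap.snd ℂ _ _))]
  · simp [mul_comm]
  · intro w
    have h : (gauge ι 𝔤).bracket (fun q => (0, a q • x)) (fun _ => w) p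
        = a p • (0, ⁅x, w.2⁆) - fderiv ℂ a p w.1 • ((0, x) : (ι → ℂ) × 𝔤) := by
      simp [gauge, dirDeriv_smul ha]
    rw [h, map_sub, map_smul, map_smul]
    simp [mul_comm]

lemma gauge_lieDeriv_const (x : 𝔤) (p : ι → ℂ)
    (ζ : Dual ℂ ((ι → ℂ) × 𝔤)) (w : (ι → ℂ) × 𝔤) :
    (gauge ι 𝔤).lieDeriv (fun _ => (0, x)) (fun _ => ζ) p w = - ζ (0, ⁅x, w.2⁆) := by
  have := gauge_lieDeriv (differentiableAt_const (c := (1 : ℂ)) (x := p)) x ζ w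
  simpa using this

variable (Λ : Dual ℂ 𝔤 →ₗ[ℂ] 𝔤)

lemma coboundaryDual_bracket_const (ξ ζ : Dual ℂ ((ι → ℂ) × 𝔤)) (p : ι → ℂ)
    (w : (ι → ℂ) × 𝔤) :
    ((gauge ι 𝔤).coboundaryDual fun _ => inGauge ι Λ).bracket (fun _ => ξ) (fun _ => ζ) p w
      = ξ (0, ⁅Λ (ζ ∘ₗ LinearMap.inr ℂ _ _), w.2⁆)
        - ζ (0, ⁅Λ (ξ ∘ₗ LinearMap.inr ℂ _ _), w.2⁆) := by
  have h (χ : Dual ℂ ((ι → ℂ) × 𝔤)) :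
      inGauge ι Λ χ = (0, Λ (χ ∘ₗ LinearMap.inr ℂ _ _)) := rfl
  simp [Algebroid.coboundaryDual, h, gauge_lieDeriv_const, Algebroid.d]
  ring

/-- The image of `Λ` lies in `𝔤`, which the projection to `T U` kills. Hence `d_*` is zero and the
Lie derivatives of `A^*` involve no differentiation. -/
lemma coboundaryDual_anchor (p : ι → ℂ) (ξ : Dual ℂ ((ι → ℂ) × 𝔤)) :
    ((gauge ι 𝔤).coboundaryDual fun _ => inGauge ι Λ).anchor p ξ = 0 := rfl

lemma coboundaryDual_lieDeriv (ξ ζ : Dual ℂ ((ι → ℂ) × 𝔤)) (Y : (ι → ℂ) → (ι → ℂ) × 𝔤)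
    (p : ι → ℂ) :
    ((gauge ι 𝔤).coboundaryDual fun _ => inGauge ι Λ).lieDeriv (fun _ => ξ)
        (fun q => evalEquiv ℂ _ (Y q)) p ζ
      = ζ (0, ⁅Λ (ξ ∘ₗ LinearMap.inr ℂ _ _), (Y p).2⁆)
        - ξ (0, ⁅Λ (ζ ∘ₗ LinearMap.inr ℂ _ _), (Y p).2⁆) := by
  rw [Algebroid.lieDeriv_eq (g := Dual.eval ℂ _ (0, ⁅Λ (ξ ∘ₗ LinearMap.inr ℂ _ _), (Y p).2⁆)
    + ξ ∘ₗ LinearMap.inr ℂ _ _ ∘ₗ (ad ℂ 𝔤 (Y p).2 : 𝔤 →ₗ[ℂ] 𝔤) ∘ₗ Λ ∘ₗ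
      (LinearMap.inr ℂ (ι → ℂ) 𝔤).dualMap)]
  · have : LinearMap.dualMap (LinearMap.inr ℂ (ι → ℂ) 𝔤) ζ = ζ ∘ₗ LinearMap.inr ℂ _ _ := rfl
    rw [← lie_skew (Λ (ζ ∘ₗ LinearMap.inr ℂ _ _)) (Y p).2, sub_eq_add_neg, ← map_neg ξ]
    simp [this]
  · intro χ
    have : LinearMap.dualMap (LinearMap.inr ℂ (ι → ℂ) 𝔤) χ = χ ∘ₗ LinearMap.inr ℂ _ _ := rfl
    simp [coboundaryDual_anchor, coboundaryDual_bracket_const, this]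
    rw [← lie_skew (Y p).2, sub_eq_add_neg, ← map_neg ξ]
    simp

/-- The `A^*`-component of the bracket of two sections of the form `a x + ξ`. -/
lemma courantBracket_snd {a c : (ι → ℂ) → ℂ} {p : ι → ℂ} (ha : DifferentiableAt ℂ a p)
    (hc : DifferentiableAt ℂ c p) (x y : 𝔤) (ξ η : Dual ℂ 𝔤) (w : (ι → ℂ) × 𝔤) :
    (courantBracket (gauge ι 𝔤) ((gauge ι 𝔤).coboundaryDual fun _ => inGauge ι Λ)
      (fun q => ((0, a q • x), ξ ∘ₗ LinearMap.snd ℂ _ _))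
      (fun q => ((0, c q • y), η ∘ₗ LinearMap.snd ℂ _ _)) p).2 w
    = ξ ⁅Λ η + c p • y, w.2⁆ - η ⁅Λ ξ + a p • x, w.2⁆
      + (1 / 2 : ℂ) * (fderiv ℂ a p w.1 * η x - fderiv ℂ c p w.1 * ξ y) := by
  have hs (χ : Dual ℂ 𝔤) : (χ ∘ₗ LinearMap.snd ℂ (ι → ℂ) 𝔤) ∘ₗ LinearMap.inr ℂ _ _ = χ := rfl
  simp [courantBracket, coboundaryDual_bracket_const, hs, gauge_lieDeriv ha, gauge_lieDeriv hc]
  have hd : (gauge ι 𝔤).d (fun q => c q * ξ y - a q * η x) p w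
      = fderiv ℂ c p w.1 * ξ y - fderiv ℂ a p w.1 * η x := by
    simp only [Algebroid.d, gauge]
    rw [fderiv_fun_sub (hc.mul_const _) (ha.mul_const _), fderiv_mul_const hc,
      fderiv_mul_const ha]
    simp [mul_comm]
  rw [hd]
  ring

/-- The `A`-component of the bracket of two sections of the form `a x + ξ`. -/
lemma courantBracket_fst {a c : (ι → ℂ) → ℂ} {p : ι → ℂ} (ha : DifferentiableAt ℂ a p)
    (hc : DifferentiableAt ℂ c p) (x y : 𝔤) (ξ η : Dual ℂ 𝔤) (ζ : Dual ℂ ((ι → ℂ) × 𝔤)) :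
    ζ (courantBracket (gauge ι 𝔤) ((gauge ι 𝔤).coboundaryDual fun _ => inGauge ι Λ)
      (fun q => ((0, a q • x), ξ ∘ₗ LinearMap.snd ℂ _ _))
      (fun q => ((0, c q • y), η ∘ₗ LinearMap.snd ℂ _ _)) p).1
    = a p * c p * ζ (0, ⁅x, y⁆)
      + c p * (ζ (0, ⁅Λ ξ, y⁆) - ξ ⁅Λ (ζ ∘ₗ LinearMap.inr ℂ _ _), y⁆)
      - a p * (ζ (0, ⁅Λ η, x⁆) - η ⁅Λ (ζ ∘ₗ LinearMap.inr ℂ _ _), x⁆) := by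
  have hs (χ : Dual ℂ 𝔤) : (χ ∘ₗ LinearMap.snd ℂ (ι → ℂ) 𝔤) ∘ₗ LinearMap.inr ℂ _ _ = χ := rfl
  have he (χ : Dual ℂ (Dual ℂ ((ι → ℂ) × 𝔤))) : ζ ((evalEquiv ℂ _).symm χ) = χ ζ := by
    obtain ⟨v, rfl⟩ := (evalEquiv ℂ _).surjective χ
    simp
  have hd (f : (ι → ℂ) → ℂ) :
      ((gauge ι 𝔤).coboundaryDual fun _ => inGauge ι Λ).d f p = 0 := by
    ext χ
    simp [Algebroid.d, coboundaryDual_anchor]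
  have hb : (gauge ι 𝔤).bracket (fun q => (0, a q • x)) (fun q => (0, c q • y)) p
      = (a p * c p) • (0, ⁅x, y⁆) := by
    simp [gauge, dirDeriv_smul ha, dirDeriv_smul hc, smul_smul, mul_comm]
  simp only [courantBracket, map_add, map_sub, map_smul, he, hd, hb, coboundaryDual_lieDeriv, hs]
  have hz (k : ℂ) (z : 𝔤) : ζ (0, k • z) = k * ζ (0, z) := by
    rw [← smul_eq_mul, ← map_smul, Prod.smul_mk, smul_zero]
  simp [hz]
  ring

end GaugeCalculus

/-! ### Root vectors, the Killing form and the sharp maps -/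

section RootVectors

lemma wedgeSharp_skew {V : Type*} [AddCommGroup V] [Module ℂ V] (x y : V) (ξ η : Dual ℂ V) :
    η (wedgeSharp x y ξ) = - ξ (wedgeSharp x y η) := by
  simp [wedgeSharp]
  ring

variable {𝔤 : Type*} [LieRing 𝔤] [LieAlgebra ℂ 𝔤] [FiniteDimensional ℂ 𝔤] [IsSimple ℂ 𝔤]
  {H : LieSubalgebra ℂ 𝔤} [H.IsCartanSubalgebra]
  {b : (IsKilling.rootSystem H).Base} (E : RootVectors b)

lemma Pos.add_ne_zero (α β : Pos b) : (α.1.1 : H → ℂ) + β.1.1 ≠ 0 := by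
  intro h
  let := (IsKilling.rootSystem H).indexNeg
  have h1 : α.1 = -β.1 := by
    apply (IsKilling.rootSystem H).root.injective
    rw [RootPairing.indexNeg_neg, RootPairing.root_reflectionPerm,
      RootPairing.reflection_apply_self]
    ext x
    have := congrFun h x
    simp at this ⊢
    linear_combination this
  have h2 := α.2
  rw [h1, RootPairing.Base.IsPos.neg_iff_not] at h2
  exact h2 β.2

lemma Pos.ext_coe {α β : Pos b} (h : (α.1.1 : H → ℂ) = β.1.1) : α = β :=
  Subtype.ext (Subtype.ext (DFunLike.coe_injective h))

lemma RootVectors.killing_same (ε : ℤˣ) (α β : Pos b) :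
    killingForm ℂ 𝔤 (E.vec ε α) (E.vec ε β) = 0 := by
  refine killingForm_apply_eq_zero_of_mem_rootSpace_of_add_ne_zero ℂ 𝔤 H (E.mem ε α) (E.mem ε β) ?_
  rw [← smul_add]
  exact smul_ne_zero (by simp) (Pos.add_ne_zero α β)

lemma RootVectors.killing_neg_of_ne (ε : ℤˣ) {α β : Pos b} (h : α ≠ β) :
    killingForm ℂ 𝔤 (E.vec ε α) (E.vec (-ε) β) = 0 := by
  refine killingForm_apply_eq_zero_of_mem_rootSpace_of_add_ne_zero ℂ 𝔤 H (E.mem ε α)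
    (E.mem (-ε) β) ?_
  rw [Units.val_neg, neg_smul, ← sub_eq_add_neg, ← smul_sub]
  exact smul_ne_zero (by simp) (sub_ne_zero.mpr fun h' => h (Pos.ext_coe h'))

lemma RootVectors.killing_neg_self (ε : ℤˣ) (α : Pos b) :
    killingForm ℂ 𝔤 (E.vec ε α) (E.vec (-ε) α) = 1 := by
  rcases Int.units_eq_one_or ε with rfl | rfl
  · exact E.norm α
  · rw [LieModule.traceForm_comm, neg_neg]
    exact E.norm α

lemma RootVectors.killing_cartan (ε : ℤˣ) (α : Pos b) (h : H) :
    killingForm ℂ 𝔤 h (E.vec ε α) = 0 := by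
  have hh : (h : 𝔤) ∈ rootSpace H (0 : H → ℂ) := by
    rw [rootSpace_zero_eq]
    exact h.2
  refine killingForm_apply_eq_zero_of_mem_rootSpace_of_add_ne_zero ℂ 𝔤 H hh (E.mem ε α) ?_
  rw [zero_add]
  refine smul_ne_zero (by simp) fun h0 => Pos.add_ne_zero α α ?_
  rw [h0, add_zero]

lemma RootVectors.vec_ne_zero (ε : ℤˣ) (α : Pos b) : E.vec ε α ≠ 0 := by
  intro h
  have := E.killing_neg_self ε α
  simp [h] at this

lemma Pos.exists_weight (ε : ℤˣ) (α : Pos b) : ∃ χ : LieModule.Weight ℂ H 𝔤,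
    χ.IsNonZero ∧ (χ : H → ℂ) = (ε : ℤ) • (α.1.1 : H → ℂ) := by
  have hα : α.1.1.IsNonZero := (Finset.mem_filter.1 α.1.2).2
  rcases Int.units_eq_one_or ε with rfl | rfl
  · exact ⟨α.1.1, hα, by simp⟩
  · exact ⟨-α.1.1, hα.neg, by simp⟩

lemma RootVectors.posSpace_eq_span (ε : ℤˣ) (α : Pos b) :
    posSpace b ε α = Submodule.span ℂ {E.vec ε α} := by
  obtain ⟨χ, hχ, hχ'⟩ := Pos.exists_weight ε α
  have h1 := IsKilling.finrank_rootSpace_eq_one χ hχ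
  have hm := E.mem ε α
  rw [posSpace, ← hχ'] at hm ⊢
  refine le_antisymm (fun x hx => ?_) (by simpa using hm)
  obtain ⟨c, hc⟩ := (finrank_eq_one_iff_of_nonzero' (⟨E.vec ε α, hm⟩ : rootSpace H χ)
    (by simpa [← Subtype.coe_inj] using E.vec_ne_zero ε α)).1 h1 ⟨x, hx⟩
  exact Submodule.mem_span_singleton.2 ⟨c, congrArg Subtype.val hc⟩

lemma RootVectors.nil_eq_span (ε : ℤˣ) :
    nil b ε = Submodule.span ℂ (Set.range (E.vec ε)) := by
  rw [nil, Submodule.span_range_eq_iSup]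
  exact iSup_congr fun α => E.posSpace_eq_span ε α

/-- A nonzero bracket makes `ε(α + β)` a root; then `α + β` is a positive root, and its root spaces
are lines. -/
lemma RootVectors.lie_vec (ε : ℤˣ) (α β : Pos b) :
    ⁅E.vec ε α, E.vec ε β⁆ = 0 ∨
      ∃ (γ : Pos b) (N : ℂ), N ≠ 0 ∧ ⁅E.vec ε α, E.vec ε β⁆ = N • E.vec ε γ := by
  by_cases h0 : ⁅E.vec ε α, E.vec ε β⁆ = 0
  · exact .inl h0
  right
  have hmem := lie_mem_genWeightSpace_of_mem_genWeightSpace (E.mem ε α) (E.mem ε β)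
  rw [← smul_add] at hmem
  have hne : (ε : ℤ) • ((α.1.1 : H → ℂ) + β.1.1) ≠ 0 :=
    smul_ne_zero (by simp) (Pos.add_ne_zero α β)
  let χ : LieModule.Weight ℂ H 𝔤 := ⟨(ε : ℤ) • ((α.1.1 : H → ℂ) + β.1.1), fun h => by
    rw [h] at hmem
    exact h0 (by simpa using hmem)⟩
  have hχ : χ.IsNonZero := hne
  -- Root vectors are indexed by positive roots, so for `ε = -1` the weight `χ` must be negated.
  obtain ⟨γ, hγ0, hγ⟩ : ∃ γ : LieModule.Weight ℂ H 𝔤, γ.IsNonZero ∧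
      (γ : H → ℂ) = (α.1.1 : H → ℂ) + β.1.1 := by
    rcases Int.units_eq_one_or ε with rfl | rfl
    · exact ⟨χ, hχ, by ext; simp [χ]⟩
    · exact ⟨-χ, hχ.neg, by ext; simp [χ]; ring⟩
  have hpos : b.IsPos ⟨γ, by simpa using hγ0⟩ := by
    refine RootPairing.Base.IsPos.add α.2 β.2 ?_
    ext x
    simpa using congrFun hγ x
  have hmem' : ⁅E.vec ε α, E.vec ε β⁆ ∈ posSpace b ε ⟨_, hpos⟩ := by
    rw [posSpace]
    simp only [hγ]
    exact hmem
  rw [E.posSpace_eq_span, Submodule.mem_span_singleton] at hmem'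
  obtain ⟨N, hN⟩ := hmem'
  exact ⟨_, N, by rintro rfl; exact h0 (by simpa using hN.symm), hN.symm⟩

/-- The covector `⟨E_{εα}, ·⟩` pairs nontrivially only with `E_{-εα}`, so a single term of a single
summand survives. Its sign is `ε` because the wedge is skew. -/
lemma rootSharp_killing_vec (c : Pos b → ℂ) (ε : ℤˣ) (α : Pos b) :
    rootSharp E c (killingForm ℂ 𝔤 (E.vec ε α)) = (((ε : ℤ) : ℂ) * c α) • E.vec ε α := by
  rw [rootSharp, LinearMap.sum_apply, Finset.sum_eq_single α]
  · have h1 := E.killing_same ε α α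
    have h2 := E.killing_neg_self ε α
    rcases Int.units_eq_one_or ε with rfl | rfl
    · simp [wedgeSharp, h1, h2]
    · rw [neg_neg] at h2
      simp [wedgeSharp, h1, h2]
  · intro β _ h
    have h1 := E.killing_same ε α β
    have h2 := E.killing_neg_of_ne ε h.symm
    rcases Int.units_eq_one_or ε with rfl | rfl
    · simp [wedgeSharp, h1, h2]
    · rw [neg_neg] at h2
      simp [wedgeSharp, h1, h2]
  · simp

lemma rootSharp_killing_cartan (c : Pos b → ℂ) (h : H) :
    rootSharp E c (killingForm ℂ 𝔤 h) = 0 := by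
  simp [rootSharp, wedgeSharp, E.killing_cartan]

lemma rootSharp_skew (c : Pos b → ℂ) (ξ η : Dual ℂ 𝔤) :
    η (rootSharp E c ξ) = - ξ (rootSharp E c η) := by
  simp only [rootSharp, LinearMap.sum_apply, LinearMap.smul_apply, map_sum, map_smul,
    wedgeSharp_skew _ _ ξ η, smul_neg, Finset.sum_neg_distrib]

lemma thetaSharp_skew (ξ η : Dual ℂ ((b.support → ℂ) × 𝔤)) :
    η (thetaSharp E ξ) = - ξ (thetaSharp E η) := by
  simp only [thetaSharp, LinearMap.sum_apply, map_sum,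
    wedgeSharp_skew _ _ ξ η, Finset.sum_neg_distrib]

lemma thetaSharp_of_snd (ξ : Dual ℂ 𝔤) :
    thetaSharp E (ξ ∘ₗ LinearMap.snd ℂ _ _) = (fun i => - ξ (simpleH E i), 0) := by
  classical
  simp only [thetaSharp, LinearMap.sum_apply, wedgeSharp]
  simp [Prod.ext_iff, Prod.fst_sum, Prod.snd_sum]
  ext i
  simp [Finset.sum_apply, Pi.single_apply]

lemma simpleH_eq (i : b.support) :
    simpleH E i =
      (IsKilling.cartanEquivDual H).symm (i.1.1 : LieModule.Weight ℂ H 𝔤).toLinear := by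
  have h1 : E.vec 1 (simplePos b i) ∈ rootSpace H i.1.1 := by
    simpa [posSpace, simplePos] using E.mem 1 (simplePos b i)
  have h2 : E.vec (-1) (simplePos b i) ∈ rootSpace H (-i.1.1 : H → ℂ) := by
    simpa [posSpace, simplePos] using E.mem (-1) (simplePos b i)
  rw [simpleH, IsKilling.lie_eq_killingForm_smul_of_mem_rootSpace_of_mem_rootSpace_neg h1 h2,
    E.norm, one_smul]

lemma killing_simpleH (i : b.support) (h : H) :
    killingForm ℂ 𝔤 h (simpleH E i) = i.1.1 h := by
  rw [simpleH_eq]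
  have := LinearMap.congr_fun ((IsKilling.cartanEquivDual H).apply_symm_apply
    (i.1.1 : LieModule.Weight ℂ H 𝔤).toLinear) h
  rw [LieModule.traceForm_comm]
  exact this

/-- The simple roots form a basis of `𝔥^*`, and `𝔥` is its own bidual. -/
lemma exists_cartan (v : b.support → ℂ) :
    ∃ h : H, ∀ i : b.support, i.1.1 h = v i := by
  let f : Dual ℂ (Dual ℂ H) := b.toWeightBasis.constr ℂ v
  refine ⟨(evalEquiv ℂ H).symm f, fun i => ?_⟩
  have := b.toWeightBasis.constr_basis ℂ v i
  rw [b.toWeightBasis_apply] at this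
  rw [← this]
  change _ = f _
  obtain ⟨x, hx⟩ := (evalEquiv ℂ H).surjective f
  rw [← hx, LinearEquiv.symm_apply_apply]
  rfl

end RootVectors

/-! ### Scalar equations extracted from integrability -/

section Dirac

variable {𝔤 : Type*} [LieRing 𝔤] [LieAlgebra ℂ 𝔤] [FiniteDimensional ℂ 𝔤] [IsSimple ℂ 𝔤]
  {H : LieSubalgebra ℂ 𝔤} [H.IsCartanSubalgebra]
  {b : (IsKilling.rootSystem H).Base} (E : RootVectors b)
  {U : Set (b.support → ℂ)} {τ : (b.support → ℂ) → Pos b → ℂ}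

lemma inGauge_apply (Λ : Dual ℂ 𝔤 →ₗ[ℂ] 𝔤) (ζ : Dual ℂ ((b.support → ℂ) × 𝔤)) :
    inGauge b.support Λ ζ = (0, Λ (ζ ∘ₗ LinearMap.inr ℂ _ _)) := rfl

lemma sharp_skew (c : Pos b → ℂ) (ξ η : Dual ℂ ((b.support → ℂ) × 𝔤)) :
    η ((thetaSharp E + inGauge b.support (rootSharp E c)) ξ)
      = - ξ ((thetaSharp E + inGauge b.support (rootSharp E c)) η) := by
  have h := rootSharp_skew E c (ξ ∘ₗ LinearMap.inr ℂ _ _) (η ∘ₗ LinearMap.inr ℂ _ _)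
  have hθ := thetaSharp_skew E ξ η
  simp only [LinearMap.add_apply, map_add, inGauge_apply, hθ]
  simp at h
  rw [h]
  ring

lemma sharp_killing_vec (c : Pos b → ℂ) (ε : ℤˣ) (α : Pos b) :
    (thetaSharp E + inGauge b.support (rootSharp E c))
        (killingForm ℂ 𝔤 (E.vec ε α) ∘ₗ LinearMap.snd ℂ _ _)
      = (0, (((ε : ℤ) : ℂ) * c α) • E.vec ε α) := by
  have hs : (killingForm ℂ 𝔤 (E.vec ε α) ∘ₗ LinearMap.snd ℂ (b.support → ℂ) 𝔤) ∘ₗ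
      LinearMap.inr ℂ _ _ = killingForm ℂ 𝔤 (E.vec ε α) := rfl
  have h0 (i : b.support) : killingForm ℂ 𝔤 (E.vec ε α) (simpleH E i) = 0 := by
    rw [LieModule.traceForm_comm, simpleH_eq, E.killing_cartan]
  rw [LinearMap.add_apply, thetaSharp_of_snd, inGauge_apply, hs, rootSharp_killing_vec]
  simp [h0]
  rfl

lemma isSection_graphL (hτ : ∀ α, DifferentiableOn ℂ (fun p => τ p α) U) (ε : ℤˣ) (α : Pos b) :
    IsSection U (graphL E τ) (fun q => ((0, (((ε : ℤ) : ℂ) * τ q α) • E.vec ε α),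
      killingForm ℂ 𝔤 (E.vec ε α) ∘ₗ LinearMap.snd ℂ _ _)) := by
  refine ⟨fun φ => ?_, fun p _ => ⟨killingForm ℂ 𝔤 (E.vec ε α) ∘ₗ LinearMap.snd ℂ _ _, ?_⟩⟩
  · have h (q : b.support → ℂ) : φ ((0, (((ε : ℤ) : ℂ) * τ q α) • E.vec ε α),
        killingForm ℂ 𝔤 (E.vec ε α) ∘ₗ LinearMap.snd ℂ _ _)
        = ((ε : ℤ) : ℂ) * τ q α * φ ((0, E.vec ε α), 0)
          + φ (0, killingForm ℂ 𝔤 (E.vec ε α) ∘ₗ LinearMap.snd ℂ _ _) := by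
      rw [← smul_eq_mul (_ * _), ← map_smul, ← map_add]
      simp
    simp only [h]
    exact (((hτ α).const_mul _).mul_const _).add_const _
  · exact Prod.ext (sharp_killing_vec E _ ε α) rfl

/-- The Dirac condition, tested on the sections of the graph over the covectors
`⟨E_{εα}, ·⟩`, `⟨E_{δβ}, ·⟩` and on a third covector `ζ`. -/
lemma IsDirac.equation (hU : IsOpen U) (hτ : ∀ α, DifferentiableOn ℂ (fun p => τ p α) U)
    (hL : IsDirac (algA b) (algAStar E) U (graphL E τ)) {p : b.support → ℂ} (hp : p ∈ U)
    (ε δ : ℤˣ) (α β : Pos b) (ζ : Dual ℂ ((b.support → ℂ) × 𝔤)) (w : (b.support → ℂ) × 𝔤)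
    (hw : (thetaSharp E + inGauge b.support (rootSharp E (τ p))) ζ = w)
    (z : 𝔤) (hz : r0Sharp E (ζ ∘ₗ LinearMap.inr ℂ _ _) = z) :
    (((ε : ℤ) : ℂ) * ((δ : ℤ) : ℂ)) * (τ p α * τ p β + τ p α + τ p β) *
        ζ (0, ⁅E.vec ε α, E.vec δ β⁆)
      - ((δ : ℤ) : ℂ) * τ p β * killingForm ℂ 𝔤 (E.vec ε α) ⁅z, E.vec δ β⁆
      + ((ε : ℤ) : ℂ) * τ p α * killingForm ℂ 𝔤 (E.vec δ β) ⁅z, E.vec ε α⁆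
    = ((ε : ℤ) : ℂ) * (1 + τ p α) * killingForm ℂ 𝔤 (E.vec δ β) ⁅E.vec ε α, w.2⁆
      - ((δ : ℤ) : ℂ) * (1 + τ p β) * killingForm ℂ 𝔤 (E.vec ε α) ⁅E.vec δ β, w.2⁆
      - (1 / 2 : ℂ) * (((ε : ℤ) : ℂ) * fderiv ℂ (fun q => τ q α) p w.1
            - ((δ : ℤ) : ℂ) * fderiv ℂ (fun q => τ q β) p w.1)
          * killingForm ℂ 𝔤 (E.vec ε α) (E.vec δ β) := by
  have hd (α : Pos b) : DifferentiableAt ℂ (fun q => τ q α) p :=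
    (hτ α).differentiableAt (hU.mem_nhds hp)
  obtain ⟨χ, hχ⟩ := (hL.integrable _ _ (isSection_graphL E hτ ε α)
    (isSection_graphL E hτ δ β)).2 p hp
  have h2 : χ = _ := congrArg Prod.snd hχ
  -- The bracket is `Λ^# χ + χ` with `Λ = θ + τ`. Its `A`-component paired with `ζ` is `ζ(Λ^# χ) =
  -- -χ(Λ^# ζ) = -χ(w)`, so both components enter one scalar equation.
  have h1 : ζ ((thetaSharp E + inGauge b.support (rootSharp E (τ p))) χ) = _ :=
    congrArg (fun v => ζ v.1) hχ
  rw [sharp_skew, h2, hw] at h1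
  rw [algA, algAStar, algA] at h1
  rw [courantBracket_snd _ ((hd α).const_mul _) ((hd β).const_mul _),
    courantBracket_fst _ ((hd α).const_mul _) ((hd β).const_mul _), hz] at h1
  have hr (ε : ℤˣ) (α : Pos b) : r0Sharp E (killingForm ℂ 𝔤 (E.vec ε α))
      = ((ε : ℤ) : ℂ) • E.vec ε α := by
    rw [r0Sharp, rootSharp_killing_vec, mul_one]
  have hs : ζ (0, ⁅E.vec δ β, E.vec ε α⁆) = - ζ (0, ⁅E.vec ε α, E.vec δ β⁆) := by
    rw [← lie_skew, ← map_neg]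
    simp
  have hm (k : ℂ) (z : 𝔤) : ζ (0, k • z) = k * ζ (0, z) := by
    rw [← smul_eq_mul, ← map_smul, Prod.smul_mk, smul_zero]
  simp only [hr, fderiv_const_mul (hd _), add_lie, smul_lie, map_add, map_smul, hm, hs,
    smul_eq_mul, smul_apply,
    LieModule.traceForm_comm ℂ 𝔤 𝔤 (E.vec δ β) (E.vec ε α)] at h1
  linear_combination -h1

lemma IsDirac.deriv_eq (hU : IsOpen U) (hτ : ∀ α, DifferentiableOn ℂ (fun p => τ p α) U)
    (hL : IsDirac (algA b) (algAStar E) U (graphL E τ)) (α : Pos b) (v : b.support → ℂ) :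
    ∃ k : ℂ, ∀ p ∈ U, fderiv ℂ (fun q => τ q α) p v = k * (τ p α * (τ p α + 2)) := by
  -- `θ^#` sends `⟨h, ·⟩` to the vector with coordinates `-α_i(h)`; the sign makes this vector `v`.
  obtain ⟨h, hh⟩ := exists_cartan (-v)
  refine ⟨killingForm ℂ 𝔤 h ⁅E.vec 1 α, E.vec (-1) α⁆, fun p hp => ?_⟩
  have hs : (killingForm ℂ 𝔤 h ∘ₗ LinearMap.snd ℂ (b.support → ℂ) 𝔤) ∘ₗ
      LinearMap.inr ℂ _ _ = killingForm ℂ 𝔤 h := rfl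
  have := hL.equation E hU hτ hp 1 (-1) α α (killingForm ℂ 𝔤 h ∘ₗ LinearMap.snd ℂ _ _) (v, 0)
    (by
      rw [LinearMap.add_apply, thetaSharp_of_snd, inGauge_apply, hs, rootSharp_killing_cartan]
      simp [killing_simpleH, hh]) 0 (by rw [hs, r0Sharp, rootSharp_killing_cartan])
  have hn := E.norm α
  simp [hn] at this
  linear_combination this

lemma IsDirac.sum_relation (hU : IsOpen U) (hτ : ∀ α, DifferentiableOn ℂ (fun p => τ p α) U)
    (hL : IsDirac (algA b) (algAStar E) U (graphL E τ)) {p : b.support → ℂ} (hp : p ∈ U)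
    {ε : ℤˣ} {α β γ : Pos b} {N : ℂ} (hN : N ≠ 0)
    (h : ⁅E.vec ε α, E.vec ε β⁆ = N • E.vec ε γ) :
    τ p α * τ p β = τ p γ * (2 + τ p α + τ p β) := by
  have hs : (killingForm ℂ 𝔤 (E.vec (-ε) γ) ∘ₗ LinearMap.snd ℂ (b.support → ℂ) 𝔤) ∘ₗ
      LinearMap.inr ℂ _ _ = killingForm ℂ 𝔤 (E.vec (-ε) γ) := rfl
  have key := hL.equation E hU hτ hp ε ε α β
    (killingForm ℂ 𝔤 (E.vec (-ε) γ) ∘ₗ LinearMap.snd ℂ _ _) _ (sharp_killing_vec E _ _ _)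
    _ (by rw [hs, r0Sharp, rootSharp_killing_vec])
  -- By invariance of the Killing form, every pairing of the three root vectors in `key` is `±N`.
  -- The derivative term drops out because `E_{εα}` and `E_{εβ}` are orthogonal.
  have hn : killingForm ℂ 𝔤 ⁅E.vec ε α, E.vec ε β⁆ (E.vec (-ε) γ) = N := by
    rw [h, map_smul, LinearMap.smul_apply, E.killing_neg_self, smul_eq_mul, mul_one]
  have h1 : killingForm ℂ 𝔤 (E.vec ε α) ⁅E.vec ε β, E.vec (-ε) γ⁆ = N := by
    rw [← hn, LieModule.traceForm_apply_lie_apply]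
  have h2 : killingForm ℂ 𝔤 (E.vec ε β) ⁅E.vec ε α, E.vec (-ε) γ⁆ = -N := by
    rw [← hn, ← lie_skew (E.vec ε α) (E.vec ε β), map_neg, LinearMap.neg_apply, neg_neg,
      LieModule.traceForm_apply_lie_apply]
  have h3 : killingForm ℂ 𝔤 (E.vec (-ε) γ) ⁅E.vec ε α, E.vec ε β⁆ = N := by
    rw [LieModule.traceForm_comm, hn]
  have hε : ((ε : ℤ) : ℂ) * ((ε : ℤ) : ℂ) = 1 := by
    rcases Int.units_eq_one_or ε with rfl | rfl <;> simp
  have h4 (x y : 𝔤) : killingForm ℂ 𝔤 x ⁅E.vec (-ε) γ, y⁆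
      = - killingForm ℂ 𝔤 x ⁅y, E.vec (-ε) γ⁆ := by
    rw [← lie_skew, map_neg]
  have hs' (x : 𝔤) : (killingForm ℂ 𝔤 (E.vec (-ε) γ) ∘ₗ LinearMap.snd ℂ (b.support → ℂ) 𝔤) (0, x)
      = killingForm ℂ 𝔤 (E.vec (-ε) γ) x := rfl
  simp only [E.killing_same, h3, smul_lie, lie_smul, h4, map_smul, smul_eq_mul, h1, h2, hs',
    Units.val_neg, Int.cast_neg] at key
  apply mul_left_cancel₀ hN
  linear_combination key - N * (τ p α * τ p β - τ p γ * (2 + τ p α + τ p β)) * hε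
end Dirac

/-! ### Vanishing at one point propagates over a connected set -/

section Vanishing

variable {ι : Type*} [Fintype ι] {U : Set (ι → ℂ)} {f : (ι → ℂ) → ℂ}

/-- Grönwall: the factor `k (f + 2)` is bounded on the compact segment, so along it `|f'| ≤ C |f|`
with initial value zero. -/
lemma eq_zero_on_segment (hU : IsOpen U) (hf : DifferentiableOn ℂ f U) {p q : ι → ℂ}
    (hpq : segment ℝ p q ⊆ U) {k : ℂ}
    (hk : ∀ x ∈ U, fderiv ℂ f x (q - p) = k * (f x * (f x + 2))) (hp : f p = 0) : f q = 0 := by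
  let γ : ℝ → ι → ℂ := fun t => p + t • (q - p)
  have hγ (t : ℝ) (ht : t ∈ Set.Icc (0 : ℝ) 1) : γ t ∈ U := by
    apply hpq
    rw [segment_eq_image']
    exact ⟨t, ht, rfl⟩
  have hγd (t : ℝ) : HasDerivAt γ (q - p) t := by
    have := ((hasDerivAt_id' t).smul_const (q - p)).const_add p
    rwa [one_smul] at this
  have hd (t : ℝ) (ht : t ∈ Set.Icc (0 : ℝ) 1) :
      HasDerivAt (f ∘ γ) (k * (f (γ t) * (f (γ t) + 2))) t := by
    have h1 := ((hf.differentiableAt (hU.mem_nhds (hγ t ht))).hasFDerivAt).restrictScalars ℝ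
    have := h1.comp_hasDerivAt t (hγd t)
    rwa [ContinuousLinearMap.coe_restrictScalars', hk _ (hγ t ht)] at this
  have hc : ContinuousOn (f ∘ γ) (Set.Icc 0 1) := fun t ht =>
    (hd t ht).continuousAt.continuousWithinAt
  obtain ⟨C, hC⟩ := isCompact_Icc.exists_bound_of_continuousOn
    (continuousOn_const (c := k) |>.mul (hc.add (continuousOn_const (c := (2 : ℂ)))))
  have := eq_zero_of_abs_deriv_le_mul_abs_self_of_eq_zero_right (K := C) hc
    (fun t ht => (hd t (Set.Ico_subset_Icc_self ht)).hasDerivWithinAt) (by simp [γ, hp])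
    (fun t ht => by
      have := hC t (Set.Ico_subset_Icc_self ht)
      calc ‖k * (f (γ t) * (f (γ t) + 2))‖ = ‖k * (f (γ t) + 2)‖ * ‖f (γ t)‖ := by
            rw [← norm_mul]; ring_nf
        _ ≤ _ := by exact mul_le_mul_of_nonneg_right this (norm_nonneg _)) 1 (by simp)
  simpa [γ] using this

lemma eq_zero_of_isPreconnected (hU : IsOpen U) (hU' : IsPreconnected U)
    (hf : DifferentiableOn ℂ f U)
    (hk : ∀ v, ∃ k : ℂ, ∀ x ∈ U, fderiv ℂ f x v = k * (f x * (f x + 2)))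
    {p q : ι → ℂ} (hp : p ∈ U) (hq : q ∈ U) (h : f p = 0) : f q = 0 := by
  have hloc (x) (hx : x ∈ U) : ∃ r > 0, Metric.ball x r ⊆ U ∧
      ∀ y ∈ Metric.ball x r, (f x = 0 ↔ f y = 0) := by
    obtain ⟨r, hr, hxr⟩ := Metric.isOpen_iff.1 hU x hx
    refine ⟨r, hr, hxr, fun y hy => ?_⟩
    have hs := ((convex_ball x r).segment_subset (Metric.mem_ball_self hr) hy).trans hxr
    refine ⟨?_, ?_⟩
    -- The constant depends on the direction, so it is chosen anew for the segment from the centre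
    -- to `y` and for the reverse one.
    · exact eq_zero_on_segment hU hf hs (hk (y - x)).choose_spec
    · exact eq_zero_on_segment hU hf (segment_symm ℝ x y ▸ hs) (hk (x - y)).choose_spec
  have := hU'.induction₂ (fun x y => f x = 0 ↔ f y = 0) (fun x hx => ?_)
    (fun _ _ _ _ _ _ => Iff.trans) (fun _ _ _ _ => Iff.symm) hp hq
  · exact this.1 h
  · obtain ⟨r, hr, -, h⟩ := hloc x hx
    exact mem_nhdsWithin_of_mem_nhds (Filter.mem_of_superset (Metric.ball_mem_nhds x hr) h)

end Vanishing

/-! ### The spaces `𝔨_±` and `𝔫°_±` in terms of root vectors -/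

section Spans

variable {𝔤 : Type*} [LieRing 𝔤] [LieAlgebra ℂ 𝔤] [FiniteDimensional ℂ 𝔤] [IsSimple ℂ 𝔤]
  {H : LieSubalgebra ℂ 𝔤} [H.IsCartanSubalgebra]
  {b : (IsKilling.rootSystem H).Base} (E : RootVectors b)

lemma viaKilling_vec (c : Pos b → ℂ) (ε : ℤˣ) (α : Pos b) :
    viaKilling (rootSharp E c) (E.vec ε α) = (((ε : ℤ) : ℂ) * c α) • E.vec ε α :=
  rootSharp_killing_vec E c ε α

lemma RootVectors.killing_sum (ε : ℤˣ) (a : Pos b → ℂ) (β : Pos b) :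
    killingForm ℂ 𝔤 (∑ α, a α • E.vec ε α) (E.vec (-ε) β) = a β := by
  rw [map_sum, LinearMap.sum_apply, Finset.sum_eq_single β]
  · rw [map_smul, LinearMap.smul_apply, E.killing_neg_self, smul_eq_mul, mul_one]
  · intro α _ h
    rw [map_smul, LinearMap.smul_apply, E.killing_neg_of_ne ε h, smul_zero]
  · simp

lemma RootVectors.mem_nil_iff {ε : ℤˣ} {x : 𝔤} :
    x ∈ nil b ε ↔ ∃ a : Pos b → ℂ, ∑ α, a α • E.vec ε α = x := by
  rw [E.nil_eq_span, Submodule.mem_span_range_iff_exists_fun]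

/-- `τ^#` is diagonal on the root vectors with eigenvalues `ε c_α`; pairing with `E_{-εα}` reads off
the coefficients. -/
lemma sum_mem_kPart_iff (c : Pos b → ℂ) (ε : ℤˣ) (a : Pos b → ℂ) :
    ∑ α, a α • E.vec ε α ∈ kPart E c ε ↔ ∀ α, c α ≠ 0 → a α = 0 := by
  have hn : ∑ α, a α • E.vec ε α ∈ nil b ε := E.mem_nil_iff.2 ⟨a, rfl⟩
  have hv : viaKilling (rootSharp E c) (∑ α, a α • E.vec ε α)
      = ∑ α, (a α * (((ε : ℤ) : ℂ) * c α)) • E.vec ε α := by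
    simp only [map_sum, map_smul, viaKilling_vec, smul_smul]
  simp only [kPart, Submodule.mem_inf, LinearMap.mem_ker, hn, and_true, hv]
  constructor
  · intro h α hα
    have := E.killing_sum ε (fun α => a α * (((ε : ℤ) : ℂ) * c α)) α
    rw [h] at this
    simpa [hα] using this.symm
  · intro h
    refine Finset.sum_eq_zero fun α _ => ?_
    by_cases hα : c α = 0
    · simp [hα]
    · simp [h α hα]

lemma kPart_eq_span (c : Pos b → ℂ) (ε : ℤˣ) :
    kPart E c ε = Submodule.span ℂ {x | ∃ α : Pos b, c α = 0 ∧ x = E.vec ε α} := by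
  classical
  apply le_antisymm
  · intro x hx
    obtain ⟨a, rfl⟩ := E.mem_nil_iff.1 hx.2
    rw [sum_mem_kPart_iff] at hx
    refine Submodule.sum_mem _ fun α _ => ?_
    by_cases hα : c α = 0
    · exact Submodule.smul_mem _ _ (Submodule.subset_span ⟨α, hα, rfl⟩)
    · simp [hx α hα]
  · rw [Submodule.span_le]
    rintro _ ⟨α, hα, rfl⟩
    refine ⟨?_, E.nil_eq_span ε ▸ Submodule.subset_span ⟨α, rfl⟩⟩
    rw [SetLike.mem_coe, LinearMap.mem_ker, viaKilling_vec, hα, mul_zero, zero_smul]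

lemma kPart_inf_nCirc (c : Pos b → ℂ) (ε : ℤˣ) : kPart E c ε ⊓ nCirc E c ε = ⊥ := by
  refine (Submodule.eq_bot_iff _).2 fun x ⟨hk, hx⟩ => ?_
  obtain ⟨a, rfl⟩ := E.mem_nil_iff.1 hk.2
  rw [SetLike.mem_coe, sum_mem_kPart_iff] at hk
  refine Finset.sum_eq_zero fun β _ => ?_
  by_cases hβ : c β = 0
  · have hle : nCirc E c ε ≤ LinearMap.ker ((killingForm ℂ 𝔤).flip (E.vec (-ε) β)) := by
      rw [nCirc, Submodule.span_le]
      rintro _ ⟨α, hα, rfl⟩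
      exact E.killing_neg_of_ne ε (by rintro rfl; exact hα hβ)
    have : a β = 0 := by
      rw [← E.killing_sum ε a β]
      exact hle hx
    rw [this, zero_smul]
  · rw [hk β hβ, zero_smul]

lemma kPart_sup_nCirc (c : Pos b → ℂ) (ε : ℤˣ) : kPart E c ε ⊔ nCirc E c ε = nil b ε := by
  rw [kPart_eq_span, nCirc, ← Submodule.span_union, E.nil_eq_span]
  congr 1
  ext x
  constructor
  · rintro (⟨α, -, rfl⟩ | ⟨α, -, rfl⟩) <;> exact ⟨α, rfl⟩
  · rintro ⟨α, rfl⟩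
    by_cases hα : c α = 0
    · exact .inl ⟨α, hα, rfl⟩
    · exact .inr ⟨α, hα, rfl⟩

omit [FiniteDimensional ℂ 𝔤] [IsSimple ℂ 𝔤] in
lemma lie_mem_of_mem_span {S T : Set 𝔤} {M : Submodule ℂ 𝔤}
    (h : ∀ x ∈ S, ∀ y ∈ T, ⁅x, y⁆ ∈ M) {x y : 𝔤} (hx : x ∈ Submodule.span ℂ S)
    (hy : y ∈ Submodule.span ℂ T) : ⁅x, y⁆ ∈ M := by
  induction hx, hy using Submodule.span_induction₂ with
  | mem_mem x y hx hy => exact h x hx y hy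
  | zero_left => simp
  | zero_right => simp
  | add_left _ _ _ _ _ _ h₁ h₂ => rw [add_lie]; exact M.add_mem h₁ h₂
  | add_right _ _ _ _ _ _ h₁ h₂ => rw [lie_add]; exact M.add_mem h₁ h₂
  | smul_left k _ _ _ _ h₁ => rw [smul_lie]; exact M.smul_mem k h₁
  | smul_right k _ _ _ _ h₁ => rw [lie_smul]; exact M.smul_mem k h₁

/-- On `E_{-α}` the map `r^# - 1` is multiplication by `-(1 + c α) - 1 = -(2 + c α)`. If this were
zero, injectivity on `𝔫°_-` would fail. -/
lemma CayleyDefined.two_add_ne_zero {c : Pos b → ℂ} (h : CayleyDefined E c) {α : Pos b}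
    (hα : c α ≠ 0) : 2 + c α ≠ 0 := by
  intro h0
  have hmem : E.vec (-1) α ∈ nCirc E c (-1) := Submodule.subset_span ⟨α, hα, rfl⟩
  refine E.vec_ne_zero (-1) α ((h (-1)).injOn hmem (Submodule.zero_mem _) ?_)
  have hr : viaKilling (r0Sharp E + rootSharp E c) (E.vec (-1) α)
      = viaKilling (rootSharp E fun _ => 1) (E.vec (-1) α)
        + viaKilling (rootSharp E c) (E.vec (-1) α) := rfl
  simp only [map_zero, sub_zero]
  rw [hr, viaKilling_vec, viaKilling_vec, ← add_smul, sub_eq_zero]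
  nth_rw 2 [← one_smul ℂ (E.vec (-1) α)]
  congr 1
  push_cast
  linear_combination -h0

end Spans

end DynR

/-! ### The lemma -/

theorem lemma4p2 {𝔤 : Type*} [LieRing 𝔤] [LieAlgebra ℂ 𝔤] [FiniteDimensional ℂ 𝔤]
    [LieAlgebra.IsSimple ℂ 𝔤]
    (H : LieSubalgebra ℂ 𝔤) [H.IsCartanSubalgebra]
    (b : (LieAlgebra.IsKilling.rootSystem H).Base)
    (E : DynR.RootVectors b)
    (U : Set (b.support → ℂ)) (hU : IsOpen U) (hU' : IsConnected U)
    (τ : (b.support → ℂ) → DynR.Pos b → ℂ)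
    (hτ : ∀ α, DifferentiableOn ℂ (fun p => τ p α) U)
    (hL : DynR.IsDirac (DynR.algA b) (DynR.algAStar E) U (DynR.graphL E τ)) :
    -- the two spaces are complementary in `𝔫_±`
    (∀ p ∈ U, ∀ ε : ℤˣ,
      DynR.kPart E (τ p) ε ⊓ DynR.nCirc E (τ p) ε = ⊥ ∧
      DynR.kPart E (τ p) ε ⊔ DynR.nCirc E (τ p) ε = DynR.nil b ε) ∧
    -- they do not depend on the point
    (∀ p ∈ U, ∀ q ∈ U, ∀ ε : ℤˣ,
      DynR.kPart E (τ p) ε = DynR.kPart E (τ q) ε ∧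
      DynR.nCirc E (τ p) ε = DynR.nCirc E (τ q) ε) ∧
    -- `𝔫°_±` is a subalgebra
    (∀ p ∈ U, ∀ ε : ℤˣ,
      ∀ x ∈ DynR.nCirc E (τ p) ε, ∀ y ∈ DynR.nCirc E (τ p) ε,
        ⁅x, y⁆ ∈ DynR.nCirc E (τ p) ε) ∧
    -- `𝔨_±` is an ideal of `𝔫_±`
    (∀ p ∈ U, DynR.CayleyDefined E (τ p) → ∀ ε : ℤˣ,
      ∀ x ∈ DynR.nil b ε, ∀ y ∈ DynR.kPart E (τ p) ε,
        ⁅x, y⁆ ∈ DynR.kPart E (τ p) ε) := by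
  have hz (α : DynR.Pos b) {p q : b.support → ℂ} (hp : p ∈ U) (hq : q ∈ U) :
      τ p α = 0 ↔ τ q α = 0 :=
    ⟨DynR.eq_zero_of_isPreconnected hU hU'.isPreconnected (hτ α)
        (fun v => hL.deriv_eq E hU hτ α v) hp hq,
      DynR.eq_zero_of_isPreconnected hU hU'.isPreconnected (hτ α)
        (fun v => hL.deriv_eq E hU hτ α v) hq hp⟩
  refine ⟨fun p _ ε => ⟨DynR.kPart_inf_nCirc E _ ε, DynR.kPart_sup_nCirc E _ ε⟩,
    fun p hp q hq ε => ⟨?_, ?_⟩, fun p hp ε x hx y hy => ?_, fun p hp hc ε x hx y hy => ?_⟩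
  · simp only [DynR.kPart_eq_span, hz _ hp hq]
  · simp only [DynR.nCirc, ne_eq, hz _ hp hq]
  · refine DynR.lie_mem_of_mem_span ?_ hx hy
    rintro _ ⟨α, hα, rfl⟩ _ ⟨β, hβ, rfl⟩
    rcases E.lie_vec ε α β with h | ⟨γ, N, hN, h⟩
    · simp [h]
    · have hrel := hL.sum_relation E hU hτ hp hN h
      rw [h]
      refine Submodule.smul_mem _ _ (Submodule.subset_span ⟨γ, fun h0 => ?_, rfl⟩)
      rw [h0, zero_mul] at hrel
      exact mul_ne_zero hα hβ hrel
  · rw [E.nil_eq_span] at hx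
    rw [DynR.kPart_eq_span] at hy ⊢
    refine DynR.lie_mem_of_mem_span ?_ hx hy
    rintro _ ⟨α, rfl⟩ _ ⟨β, hβ, rfl⟩
    rcases E.lie_vec ε α β with h | ⟨γ, N, hN, h⟩
    · simp [h]
    · have hrel := hL.sum_relation E hU hτ hp hN h
      rw [h]
      refine Submodule.smul_mem _ _ (Submodule.subset_span ⟨γ, ?_, rfl⟩)
      rw [hβ, mul_zero, add_zero, zero_eq_mul] at hrel
      refine hrel.resolve_right fun h2 => ?_
      -- The Cayley condition concerns only roots with `τ_α ≠ 0`; when `τ_α = 0` the factor `2 +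
      -- τ_α` is `2`.
      by_cases hα : τ p α = 0
      · simp [hα] at h2
      · exact hc.two_add_ne_zero E hα h2
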